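/- Let $(c_n)_{n\ge 1}$ be any sequence of real numbers with $\lim_{n\to\infty} c_n=+\infty$. Then there is a continuous, Lebesgue-integrable function $f:\mathbb R\to\mathbb R$ such that $$\limsup_{n\to\infty} c_n\, f(nx)=+\infty\qquad\text{for every real } x\neq 0,$$ where $n$ runs through the positive integers. -/

import Mathlib

open MeasureTheory Filter

/-! Take f = ∑ g_k with g_k ≥ 0 and both sup and integral at most 2^{-k}, such that each |x| ≤ k has
some n ≥ k with c_n g_k(nx) ≥ k. By Dirichlet, some n ≤ Q puts nx within 1/Q of an integer of size
at most kQ + 1, so bumps of width about 1/Q at those integers catch nx, with total mass bounded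
independently of Q. The bump height can thus be fixed first, and n then forced large enough for c_n
to beat it (`exists_mul_near_int`). -/

/-- The tent function of height `2` supported on `[-2, 2]`. -/
noncomputable def tent (t : ℝ) : ℝ := max 0 (2 - |t|)

lemma continuous_tent : Continuous tent := by
  unfold tent; fun_prop

lemma tent_nonneg (t : ℝ) : 0 ≤ tent t := le_max_left _ _

lemma one_le_tent {t : ℝ} (ht : |t| ≤ 1) : 1 ≤ tent t :=
  le_max_of_le_right (by linarith)

lemma hasCompactSupport_tent : HasCompactSupport tent := by
  refine HasCompactSupport.intro (isCompact_Icc (a := (-2 : ℝ)) (b := 2)) fun t ht => ?_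
  have : 2 < |t| := by
    by_contra! h
    exact ht (abs_le.mp h)
  exact max_eq_left (by linarith)

lemma integrable_tent : Integrable tent :=
  continuous_tent.integrable_of_hasCompactSupport hasCompactSupport_tent

/-- The sum of the tents of half-width `2 * w` centred at the integers in `[-M, M]`. -/
noncomputable def tentComb (w : ℝ) (M : ℕ) (y : ℝ) : ℝ :=
  ∑ m ∈ Finset.Icc (-(M : ℤ)) M, tent ((y - m) / w)

lemma continuous_tentComb (w : ℝ) (M : ℕ) : Continuous (tentComb w M) := by
  unfold tentComb
  exact continuous_finsetSum _ fun m _ => continuous_tent.comp (by fun_prop)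

lemma tentComb_nonneg (w : ℝ) (M : ℕ) (y : ℝ) : 0 ≤ tentComb w M y :=
  Finset.sum_nonneg fun _ _ => tent_nonneg _

lemma one_le_tentComb {w : ℝ} (hw : 0 < w) {M : ℕ} {y : ℝ} {m : ℤ}
    (hm : |(m : ℝ)| ≤ M) (hy : |y - m| ≤ w) : 1 ≤ tentComb w M y := by
  have hmem : m ∈ Finset.Icc (-(M : ℤ)) M := by
    rw [Finset.mem_Icc, ← abs_le]
    exact_mod_cast hm
  calc (1 : ℝ) ≤ tent ((y - m) / w) :=
        one_le_tent (by rw [abs_div, abs_of_pos hw]; exact (div_le_one hw).mpr hy)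
    _ ≤ tentComb w M y := Finset.single_le_sum
        (f := fun m : ℤ => tent ((y - m) / w)) (fun _ _ => tent_nonneg _) hmem

lemma integrable_tent_comp {w : ℝ} (hw : 0 < w) (a : ℝ) :
    Integrable fun y => tent ((y - a) / w) :=
  (integrable_tent.comp_div hw.ne').comp_sub_right a

lemma integrable_tentComb {w : ℝ} (hw : 0 < w) (M : ℕ) : Integrable (tentComb w M) := by
  unfold tentComb
  exact integrable_finsetSum _ fun m _ => integrable_tent_comp hw m

lemma integral_tentComb {w : ℝ} (hw : 0 < w) (M : ℕ) :
    ∫ y, tentComb w M y = (2 * M + 1) * w * ∫ t, tent t := by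
  unfold tentComb
  rw [integral_finsetSum _ fun (m : ℤ) _ => integrable_tent_comp hw (m : ℝ)]
  have h (m : ℤ) : ∫ y, tent ((y - m) / w) = w * ∫ t, tent t := by
    rw [integral_sub_right_eq_self (fun y => tent (y / w)) (m : ℝ), Measure.integral_comp_div,
      abs_of_pos hw, smul_eq_mul]
  simp only [h, Finset.sum_const, Int.card_Icc, nsmul_eq_mul]
  have : ((M : ℤ) + 1 - -(M : ℤ)).toNat = 2 * M + 1 := by omega
  rw [this]
  push_cast
  ring

/-- Dirichlet's approximation theorem with a lower bound `N` on the multiplier: multipliers below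
`N` are replaced by `N !`, at the price of a worse approximation. -/
lemma exists_mul_near_int (N b Q : ℕ) (hQ : N.factorial ≤ Q) {x : ℝ}
    (hx : |x| ≤ b) :
    ∃ n ≥ N, ∃ m : ℤ,
      (|(n : ℝ) * x - m| ≤ 1 / Q ∧ |(m : ℝ)| ≤ (b * Q + 1 : ℕ)) ∨
      (|(n : ℝ) * x - m| ≤ N.factorial / Q ∧ |(m : ℝ)| ≤ (b * N.factorial + 1 : ℕ)) := by
  have hD : 0 < N.factorial := N.factorial_pos
  have hQ0 : 0 < Q := hD.trans_le hQ
  have hQ1 : (0 : ℝ) < Q := by exact_mod_cast hQ0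
  have near (n R : ℕ) (m : ℤ) (hn : n ≤ R) (h : |(n : ℝ) * x - m| ≤ 1) :
      |(m : ℝ)| ≤ (b * R + 1 : ℕ) := by
    have h1 : |(n : ℝ) * x| ≤ R * b := by
      rw [abs_mul, Nat.abs_cast]
      gcongr
    have h2 := abs_sub_abs_le_abs_sub (m : ℝ) (n * x)
    rw [abs_sub_comm] at h2
    push_cast
    linarith
  obtain ⟨k, hk0, hkQ, hk⟩ := Real.exists_nat_abs_mul_sub_round_le x hQ0
  set m := round ((k : ℝ) * x)
  have hk' : |(k : ℝ) * x - m| ≤ 1 / Q :=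
    hk.trans (one_div_le_one_div_of_le hQ1 (by linarith))
  by_cases hkN : N ≤ k
  · refine ⟨k, hkN, m, Or.inl ⟨hk', near k Q m hkQ (hk'.trans ?_)⟩⟩
    rw [div_le_one hQ1]
    exact_mod_cast hQ0
  -- A multiplier k < N divides N!; scaling by the cofactor e ≤ N! multiplies the error by at most
  -- N!.
  · obtain ⟨e, he⟩ := Nat.dvd_factorial hk0 (not_le.mp hkN).le
    have heD : e ≤ N.factorial := by
      rw [he]; exact Nat.le_mul_of_pos_left e hk0
    have happ : |(N.factorial : ℝ) * x - ((e * m : ℤ) : ℝ)| ≤ N.factorial / Q := by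
      have : (N.factorial : ℝ) * x - ((e * m : ℤ) : ℝ) = e * (k * x - m) := by
        rw [he]; push_cast; ring
      rw [this, abs_mul, Nat.abs_cast]
      calc (e : ℝ) * |(k : ℝ) * x - m| ≤ N.factorial * (1 / Q) := by gcongr
        _ = N.factorial / Q := by ring
    refine ⟨N.factorial, N.self_le_factorial, e * m, Or.inr ⟨happ, near _ _ _ le_rfl ?_⟩⟩
    refine happ.trans ((div_le_one hQ1).mpr ?_)
    exact_mod_cast hQ

/-- The clause `0 ≤ c n` lets the lower bound survive when the other nonnegative bumps are added. -/
lemma exists_bump_large_along_multiples {c : ℕ → ℝ} (hc : Tendsto c atTop atTop)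
    (b N₀ : ℕ) (K : ℝ) {ε : ℝ} (hε : 0 < ε) :
    ∃ g : ℝ → ℝ, Continuous g ∧ Integrable g ∧ (∀ y, 0 ≤ g y) ∧ (∀ y, g y ≤ ε) ∧
      ∫ y, g y ≤ ε ∧ ∀ x : ℝ, |x| ≤ b → ∃ n ≥ N₀, 0 ≤ c n ∧ K ≤ c n * g (n * x) := by
  set I := ∫ t, tent t
  have hI : 0 ≤ I := integral_nonneg tent_nonneg
  -- The height depends only on b and ε, so N may be chosen after it.
  set h := ε / ((2 * b + 4) * I + 1) with hh
  have hden : 1 ≤ (2 * b + 4) * I + 1 := by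
    have : 0 ≤ (2 * b + 4) * I := by positivity
    linarith
  have hpos : 0 < h := by positivity
  have hle : h ≤ ε := div_le_self hε.le hden
  obtain ⟨N₁, hN₁⟩ := eventually_atTop.mp (hc.eventually_ge_atTop (max 0 (K / h)))
  set N := max N₀ N₁ + 1
  set D := N.factorial
  have hD : 0 < D := N.factorial_pos
  -- Makes the 2(bD + 1) + 1 tents of scale D/Q have total scale exactly 1.
  set Q := D * (2 * (b * D + 1) + 1)
  have hDQ : D ≤ Q := Nat.le_mul_of_pos_right D (by omega)
  have hQ : (0 : ℝ) < Q := by exact_mod_cast hD.trans_le hDQ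
  have hD' : (0 : ℝ) < D := by exact_mod_cast hD
  have hQ1 : (1 : ℝ) ≤ Q := by exact_mod_cast hD.trans_le hDQ
  set F : ℝ → ℝ := fun y =>
    tentComb (1 / Q) (b * Q + 1) y + tentComb (D / Q) (b * D + 1) y
  have hFc : Continuous F := (continuous_tentComb _ _).add (continuous_tentComb _ _)
  have hF0 (y : ℝ) : 0 ≤ F y := add_nonneg (tentComb_nonneg _ _ _) (tentComb_nonneg _ _ _)
  have hi₁ := integrable_tentComb (w := 1 / Q) (by positivity) (b * Q + 1)
  have hi₂ := integrable_tentComb (w := D / Q) (by positivity) (b * D + 1)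
  have hFi : Integrable F := hi₁.add hi₂
  have hFint : ∫ y, F y ≤ (2 * b + 4) * I := by
    have : ∫ y, F y = ((2 * b * Q + 3) / Q + 1) * I := by
      rw [integral_add hi₁ hi₂, integral_tentComb (by positivity),
        integral_tentComb (by positivity)]
      have hQe : (Q : ℝ) = D * (2 * (b * D + 1) + 1) := by simp [Q]
      have : (2 * ((b * D + 1 : ℕ) : ℝ) + 1) * (D / Q) = 1 := by
        push_cast
        rw [mul_div_assoc', div_eq_one_iff_eq hQ.ne', hQe]
        ring
      rw [this]
      push_cast
      ring
    rw [this]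
    refine mul_le_mul_of_nonneg_right ?_ hI
    have : (2 * b * Q + 3) / (Q : ℝ) ≤ 2 * b + 3 := by
      rw [div_le_iff₀ hQ]; linarith
    linarith
  -- Tents may overlap; capping at 1 keeps the sup at most h.
  have hgi : Integrable fun y => h * min 1 (F y) := by
    refine (hFi.mono' (by fun_prop) (Eventually.of_forall fun y => ?_)).const_mul h
    rw [Real.norm_of_nonneg (le_min zero_le_one (hF0 y))]
    exact min_le_right _ _
  refine ⟨fun y => h * min 1 (F y), by fun_prop, hgi,
    fun y => mul_nonneg hpos.le (le_min zero_le_one (hF0 y)),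
    fun y => (mul_le_of_le_one_right hpos.le (min_le_left _ _)).trans hle, ?_, fun x hx => ?_⟩
  · calc ∫ y, h * min 1 (F y) ≤ ∫ y, h * F y :=
          integral_mono hgi (hFi.const_mul h) fun y =>
            mul_le_mul_of_nonneg_left (min_le_right _ _) hpos.le
      _ = h * ∫ y, F y := integral_const_mul _ _
      _ ≤ h * ((2 * b + 4) * I + 1) := by gcongr; linarith
      _ = ε := div_mul_cancel₀ _ (by positivity)
  · obtain ⟨n, hn, m, hm⟩ := exists_mul_near_int N b Q hDQ hx
    have hn' : max 0 (K / h) ≤ c n := hN₁ n (by omega)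
    have hF1 : 1 ≤ F (n * x) := by
      rcases hm with ⟨h1, h2⟩ | ⟨h1, h2⟩
      · exact (one_le_tentComb (by positivity) h2 h1).trans
          (le_add_of_nonneg_right (tentComb_nonneg _ _ _))
      · exact (one_le_tentComb (by positivity) h2 h1).trans
          (le_add_of_nonneg_left (tentComb_nonneg _ _ _))
    refine ⟨n, by omega, (le_max_left _ _).trans hn', ?_⟩
    simp only [min_eq_left hF1, mul_one]
    exact (div_le_iff₀ hpos).mp ((le_max_right _ _).trans hn')

theorem theorem1 (c : ℕ → ℝ) (hc : Filter.Tendsto c Filter.atTop Filter.atTop) :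
    ∃ f : ℝ → ℝ, Continuous f ∧ MeasureTheory.Integrable f MeasureTheory.volume ∧
      ∀ x : ℝ, x ≠ 0 →
        Filter.limsup (fun n : ℕ => ((c n * f ((n : ℝ) * x) : ℝ) : EReal)) Filter.atTop = ⊤ := by
  choose g hgc hgi hg0 hgle hgint hg using fun k : ℕ =>
    exists_bump_large_along_multiples hc k k k (ε := (1 / 2) ^ k) (by positivity)
  have hsum : Summable fun k : ℕ => ((1 : ℝ) / 2) ^ k := summable_geometric_two
  have hnorm (k : ℕ) (y : ℝ) : ‖g k y‖ ≤ (1 / 2) ^ k := by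
    rw [Real.norm_of_nonneg (hg0 k y)]; exact hgle k y
  have hs (y : ℝ) : Summable fun k => g k y := hsum.of_norm_bounded fun k => hnorm k y
  have hcont : Continuous fun y => ∑' k, g k y := continuous_tsum hgc hsum hnorm
  refine ⟨fun y => ∑' k, g k y, hcont, ?_, fun x _ => ?_⟩
  · refine ⟨hcont.aestronglyMeasurable, ?_⟩
    rw [hasFiniteIntegral_iff_ofReal (Eventually.of_forall fun y => tsum_nonneg fun k => hg0 k y)]
    calc ∫⁻ y, ENNReal.ofReal (∑' k, g k y) = ∫⁻ y, ∑' k, ENNReal.ofReal (g k y) := by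
          simp_rw [fun y => ENNReal.ofReal_tsum_of_nonneg (fun k => hg0 k y) (hs y)]
      _ = ∑' k, ∫⁻ y, ENNReal.ofReal (g k y) :=
          lintegral_tsum fun k => (hgc k).measurable.ennreal_ofReal.aemeasurable
      _ ≤ ∑' k, ENNReal.ofReal ((1 / 2) ^ k) := by
          refine ENNReal.tsum_le_tsum fun k => ?_
          rw [← ofReal_integral_eq_lintegral_ofReal (hgi k) (Eventually.of_forall (hg0 k))]
          exact ENNReal.ofReal_le_ofReal (hgint k)
      _ = ENNReal.ofReal (∑' k, (1 / 2) ^ k) :=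
          (ENNReal.ofReal_tsum_of_nonneg (fun k => by positivity) hsum).symm
      _ < ⊤ := ENNReal.ofReal_lt_top
  · refine EReal.eq_top_iff_forall_lt _ |>.mpr fun K => ?_
    suffices ((K + 1 : ℝ) : EReal) ≤
        limsup (fun n : ℕ => ((c n * ∑' k, g k (n * x) : ℝ) : EReal)) atTop from
      (EReal.coe_lt_coe_iff.mpr (lt_add_one K)).trans_le this
    refine le_limsup_of_frequently_le (frequently_atTop.mpr fun N => ?_) (by isBoundedDefault)
    obtain ⟨k, hk⟩ := exists_nat_ge (max (max |x| (K + 1)) N)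
    simp only [max_le_iff, Nat.cast_le] at hk
    obtain ⟨n, hn, hcn, hle⟩ := hg k x hk.1.1
    refine ⟨n, hk.2.trans hn, EReal.coe_le_coe_iff.mpr ?_⟩
    calc K + 1 ≤ k := hk.1.2
      _ ≤ c n * g k (n * x) := hle
      _ ≤ c n * ∑' k, g k (n * x) :=
          mul_le_mul_of_nonneg_left ((hs _).le_tsum k fun j _ => hg0 j _) hcn
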